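/- Let $d_I\ge 1$, $d_O\ge 2$, $d_E\ge 1$ be integers with $d_I\le d_Od_E$. Let $V:\mathbb C^{d_I}\to\mathbb C^{d_O}\otimes\mathbb C^{d_E}$ be a Haar-random isometry (the first $d_I$ columns of a Haar-random unitary on $\mathbb C^{d_O}\otimes\mathbb C^{d_E}$), let $|V\rangle=\sum_i|i\rangle\otimes V|i\rangle$ be its Choi vector, and let $C=\operatorname{tr}_E|V\rangle\langle V|$ be the Choi operator of the random channel $X\mapsto\operatorname{tr}_E(VXV^*)$; $\mathbb E$ denotes the average over $V$. Let $c_1^\downarrow\ge c_2^\downarrow\ge\cdots\ge c_{d_Id_O}^\downarrow\ge 0$ be the eigenvalues of $C$ in non-increasing order, with multiplicity. For a density matrix $\rho_E$ on $\mathbb C^{d_E}$, the strategy that outputs $C\otimes\rho_E$ has average purification error $$\epsilon_{\mathrm{app}\text{-}\rho_E}=\mathbb E\Big[\min_{U_E}\big\|C\otimes\rho_E-(\mathbb 1\otimes U_E)|V\rangle\langle V|(\mathbb 1\otimes U_E^*)\big\|_2^2\Big],$$ where $U_E$ ranges over the unitaries on $\mathbb C^{d_E}$ and $\|\cdot\|_2$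 is the Hilbert–Schmidt norm. Put $\epsilon_{\mathrm{app}}=\min_{\rho_E}\epsilon_{\mathrm{app}\text{-}\rho_E}$, the minimum over all density matrices $\rho_E$ on $\mathbb C^{d_E}$. Then all these expectations are well defined, both minima are attained, and $$\mathbb E[\operatorname{tr}C^2]=\frac{d_Id_O(d_E^2-1)+d_I^2d_E(d_O^2-1)}{d_O^2d_E^2-1},$$ $$\epsilon_{\mathrm{app}}=d_I^2-\frac{\sum_i\big(\mathbb E[(c_i^\downarrow)^2]\big)^2}{\mathbb E[\operatorname{tr}C^2]} =d_I^2-\frac{d_O^2d_E^2-1}{d_Id_O(d_E^2-1)+d_I^2d_E(d_O^2-1)}\sum_i\big(\mathbb E[(c_i^\downarrow)^2]\big)^2 .$$ Moreover $$d_I^2-\frac{d_Id_O(d_E^2-1)+d_I^2d_E(d_O^2-1)}{d_O^2d_E^2-1}\;\le\;\epsilon_{\mathrm{app}}\;\le\; d_I^2-\frac1{d_E}\,\frac{d_Id_O(d_E^2-1)+d_I^2d_E(d_O^2-1)}{d_O^2d_E^2-1},$$ and the right-hand side is exactly the error $\epsilon_{\mathrm{app}\text{-}\mathbb 1/d_E}$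 of the strategy that appends the maximally mixed state $\rho_E=\mathbb 1/d_E$. -/

import Mathlib

open scoped Matrix Kronecker ComplexOrder
open MeasureTheory

namespace AppendEnv

/-! ### Choi operators, dilations, states -/

/-- The Choi vector `|V⟩ = ∑ᵢ |i⟩ ⊗ V|i⟩ ∈ H_I ⊗ H_O ⊗ H_E` of an operator
`V : H_I → H_O ⊗ H_E`. -/
def choiVec {dI dO dE : ℕ} (V : Matrix (Fin dO × Fin dE) (Fin dI) ℂ) :
    (Fin dI × Fin dO) × Fin dE → ℂ :=
  fun x => V (x.1.2, x.2) x.1.1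

/-- The rank-one Choi operator `|V⟩⟨V|` on `H_I ⊗ H_O ⊗ H_E`. -/
def choiProj {dI dO dE : ℕ} (V : Matrix (Fin dO × Fin dE) (Fin dI) ℂ) :
    Matrix ((Fin dI × Fin dO) × Fin dE) ((Fin dI × Fin dO) × Fin dE) ℂ :=
  Matrix.vecMulVec (choiVec V) (star (choiVec V))

/-- The partial trace over the second tensor factor. -/
def partialTraceRight {α β : Type*} [Fintype β] (M : Matrix (α × β) (α × β) ℂ) :
    Matrix α α ℂ :=
  Matrix.of fun a b => ∑ e, M (a, e) (b, e)

/-- The Choi operator `C = tr_E |V⟩⟨V|` on `H_I ⊗ H_O` of the channel with Stinespring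
operator `V`. -/
def choiOp {dI dO dE : ℕ} (V : Matrix (Fin dO × Fin dE) (Fin dI) ℂ) :
    Matrix (Fin dI × Fin dO) (Fin dI × Fin dO) ℂ :=
  partialTraceRight (choiProj V)

theorem choiOp_isHermitian {dI dO dE : ℕ} (V : Matrix (Fin dO × Fin dE) (Fin dI) ℂ) :
    (choiOp V).IsHermitian := by
  ext a b
  simp [choiOp, partialTraceRight, choiProj, Matrix.vecMulVec_apply, Matrix.conjTranspose_apply,
    mul_comm]

/-- The eigenvalues `c₀ ≥ c₁ ≥ ⋯` of `C`, listed with multiplicity in non-increasing order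
(there are `d_I d_O` of them, those beyond the rank of `C` being zero). -/
noncomputable def orderedEig {dI dO dE : ℕ} (V : Matrix (Fin dO × Fin dE) (Fin dI) ℂ)
    (i : Fin (Fintype.card (Fin dI × Fin dO))) : ℝ :=
  (choiOp_isHermitian V).eigenvalues₀ i

/-- The purity `tr (C²)`. -/
noncomputable def purity {dI dO dE : ℕ} (V : Matrix (Fin dO × Fin dE) (Fin dI) ℂ) : ℝ :=
  (Matrix.trace (choiOp V * choiOp V)).re

/-- The Choi operator `(𝟙 ⊗ U_E) |V⟩⟨V| (𝟙 ⊗ U_E)*` of the purification of `C` obtained from `V`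
by the environment unitary `U_E`. -/
noncomputable def rotatedProj {dI dO dE : ℕ} (V : Matrix (Fin dO × Fin dE) (Fin dI) ℂ)
    (U : Matrix.unitaryGroup (Fin dE) ℂ) :
    Matrix ((Fin dI × Fin dO) × Fin dE) ((Fin dI × Fin dO) × Fin dE) ℂ :=
  ((1 : Matrix (Fin dI × Fin dO) (Fin dI × Fin dO) ℂ) ⊗ₖ (U : Matrix (Fin dE) (Fin dE) ℂ)) *
    choiProj V *
    ((1 : Matrix (Fin dI × Fin dO) (Fin dI × Fin dO) ℂ) ⊗ₖ (U : Matrix (Fin dE) (Fin dE) ℂ))ᴴ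

/-- Density matrices on `ℂ^d`. -/
def densityMatrices (d : ℕ) : Set (Matrix (Fin d) (Fin d) ℂ) :=
  {ρ | ρ.PosSemidef ∧ ρ.trace = 1}

/-- The maximally mixed state `𝟙/d`. -/
noncomputable def maxMixed (d : ℕ) : Matrix (Fin d) (Fin d) ℂ :=
  ((d : ℂ)⁻¹) • (1 : Matrix (Fin d) (Fin d) ℂ)

/-- The squared Hilbert–Schmidt norm `‖M‖₂² = tr (M* M)`. -/
noncomputable def hsNormSq {α : Type*} [Fintype α] (M : Matrix α α ℂ) : ℝ :=
  (Matrix.trace (Mᴴ * M)).re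

/-! ### Haar-random Stinespring isometries -/

instance compactSpace_unitaryGroup {n : Type*} [Fintype n] [DecidableEq n] :
    CompactSpace (Matrix.unitaryGroup n ℂ) := by
  have hK : IsCompact (Set.pi Set.univ fun _ : n => Set.pi Set.univ fun _ : n =>
      Metric.closedBall (0 : ℂ) 1) :=
    isCompact_univ_pi fun _ => isCompact_univ_pi fun _ => isCompact_closedBall _ _
  have hc : IsCompact (Matrix.unitaryGroup n ℂ : Set (Matrix n n ℂ)) := by
    have hcl : IsClosed (Matrix.unitaryGroup n ℂ : Set (Matrix n n ℂ)) := isClosed_unitary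
    refine hK.of_isClosed_subset hcl ?_
    intro U hU i _ j _
    simpa using entry_norm_bound_of_unitary hU i j
  exact isCompact_iff_compactSpace.mp hc

/-- The Borel σ-algebra of the unitary group. -/
noncomputable instance measurableSpace_unitaryGroup {n : Type*} [Fintype n] [DecidableEq n] :
    MeasurableSpace (Matrix.unitaryGroup n ℂ) := borel _

instance borelSpace_unitaryGroup {n : Type*} [Fintype n] [DecidableEq n] :
    BorelSpace (Matrix.unitaryGroup n ℂ) := ⟨rfl⟩

/-- The Haar probability measure on the unitary group. -/
noncomputable def haarUnitary (n : Type*) [Fintype n] [DecidableEq n] :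
    Measure (Matrix.unitaryGroup n ℂ) :=
  Measure.haarMeasure ⊤

instance isProbabilityMeasure_haarUnitary {n : Type*} [Fintype n] [DecidableEq n] :
    IsProbabilityMeasure (haarUnitary n) :=
  ⟨by simpa [haarUnitary] using
    Measure.haarMeasure_self (K₀ := (⊤ : TopologicalSpace.PositiveCompacts
      (Matrix.unitaryGroup n ℂ)))⟩

/-- The first `d_I` columns of a unitary on `H_O ⊗ H_E`. -/
def firstColumns {dI dO dE : ℕ} (h : dI ≤ dO * dE)
    (U : Matrix.unitaryGroup (Fin dO × Fin dE) ℂ) : Matrix (Fin dO × Fin dE) (Fin dI) ℂ :=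
  Matrix.of fun x i =>
    (U : Matrix (Fin dO × Fin dE) (Fin dO × Fin dE) ℂ) x (finProdFinEquiv.symm (Fin.castLE h i))

/-- Expectation of `f V` over a Haar-random isometry `V : H_I → H_O ⊗ H_E`, i.e. the first `d_I`
columns of a Haar-random unitary. -/
noncomputable def haarExp {dI dO dE : ℕ} (h : dI ≤ dO * dE)
    (f : Matrix (Fin dO × Fin dE) (Fin dI) ℂ → ℝ) : ℝ :=
  ∫ U, f (firstColumns h U) ∂(haarUnitary (Fin dO × Fin dE))

/-- Integrability of `f V` for a Haar-random isometry `V`. -/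
def HaarIntegrable {dI dO dE : ℕ} (h : dI ≤ dO * dE)
    (f : Matrix (Fin dO × Fin dE) (Fin dI) ℂ → ℝ) : Prop :=
  Integrable (fun U => f (firstColumns h U)) (haarUnitary (Fin dO × Fin dE))

/-! ### Append-environment strategies and their errors -/

/-- The output `C ⊗ ρ_E` of the append-environment strategy on the input `C`. -/
def appendEnv {dI dO dE : ℕ} (ρ : Matrix (Fin dE) (Fin dE) ℂ)
    (C : Matrix (Fin dI × Fin dO) (Fin dI × Fin dO) ℂ) :
    Matrix ((Fin dI × Fin dO) × Fin dE) ((Fin dI × Fin dO) × Fin dE) ℂ :=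
  C ⊗ₖ ρ

/-- The squared Hilbert–Schmidt distance of the output to the purification given by `U`. -/
noncomputable def dist2 {dI dO dE : ℕ} (ρ : Matrix (Fin dE) (Fin dE) ℂ)
    (V : Matrix (Fin dO × Fin dE) (Fin dI) ℂ) (U : Matrix.unitaryGroup (Fin dE) ℂ) : ℝ :=
  hsNormSq (appendEnv ρ (choiOp V) - rotatedProj V U)

/-- The smallest squared distance of the output to a purification of the input. -/
noncomputable def bestDist2 {dI dO dE : ℕ} (ρ : Matrix (Fin dE) (Fin dE) ℂ)
    (V : Matrix (Fin dO × Fin dE) (Fin dI) ℂ) : ℝ :=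
  ⨅ U : Matrix.unitaryGroup (Fin dE) ℂ, dist2 ρ V U

/-- The average error of the strategy `C ↦ C ⊗ ρ_E`. -/
noncomputable def appError {dI dO dE : ℕ} (h : dI ≤ dO * dE)
    (ρ : Matrix (Fin dE) (Fin dE) ℂ) : ℝ :=
  haarExp h (bestDist2 ρ)

/-- The least average error over all append-environment strategies. -/
noncomputable def epsApp {dI dO dE : ℕ} (h : dI ≤ dO * dE) : ℝ :=
  sInf (appError h '' densityMatrices dE)

end AppendEnv

/-!
Let `σ` be the reduced operator of the Choi vector on the environment; it has the same nonzero
eigenvalues `c_k` as `C`. For `|V_U⟩ = (𝟙 ⊗ U)|V⟩`, expanding the squared norm gives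
`‖C ⊗ ρ - |V_U⟩⟨V_U|‖₂² = tr C² · tr ρ² + d_I² - 2 tr (ρ U σ² U*)`, and von Neumann's trace theorem
maximizes the last term over `U`: the maximum is `∑ r_k c_k²`, where `r_k` are the ordered
eigenvalues of `ρ`. Averaging and completing the square with `P = 𝔼 tr C²` and `m_k = 𝔼 c_k²` yields
`d_I² - (∑ m_k²) / P + P ∑ (r_k - m_k / P)²`. As `m` is non-increasing and `∑ m_k = P`, the numbers
`m_k / P` are the ordered eigenvalues of a state.

For the value of `P`, Schur–Weyl duality shows that the average of `(U ⊗ U) X (U ⊗ U)*` is a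
combination of the identity and the swap, with coefficients determined by two traces.
-/

namespace AppendEnv

section Spectrum

/-- The enumeration of a finite type by which Mathlib orders eigenvalues. -/
noncomputable def eigIndex {n : Type*} [Fintype n] : n ≃ Fin (Fintype.card n) :=
  (Fintype.equivOfCardEq (Fintype.card_fin (Fintype.card n))).symm

theorem sum_eigIndex {n : Type*} [Fintype n] (f : ℕ → ℝ) :
    ∑ i : n, f (eigIndex i) = ∑ k ∈ Finset.range (Fintype.card n), f k := by
  rw [← Fin.sum_univ_eq_sum_range]
  exact Equiv.sum_comp eigIndex fun k : Fin (Fintype.card n) => f k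

variable {m n : Type*} [Fintype m] [DecidableEq m] [Fintype n] [DecidableEq n] {A : Matrix n n ℂ}

/-- The eigenvalues of a Hermitian matrix with multiplicity, in non-increasing order and continued
by zeros. Reading them off the characteristic polynomial makes this a total function of the matrix,
so that spectra of matrices of different sizes can be compared by an equality of sequences. -/
noncomputable def eigSeq (A : Matrix n n ℂ) (k : ℕ) : ℝ :=
  ((A.charpoly.roots.map RCLike.re).sort (· ≥ ·)).getD k 0

theorem eigSeq_of_card_le (A : Matrix n n ℂ) {k : ℕ} (hk : Fintype.card n ≤ k) :
    eigSeq A k = 0 := by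
  refine List.getD_eq_default _ _ (le_trans ?_ hk)
  rw [Multiset.length_sort, Multiset.card_map, ← A.charpoly_natDegree_eq_dim]
  exact A.charpoly.card_roots'

theorem eigSeq_fin (hA : A.IsHermitian) (k : Fin (Fintype.card n)) :
    eigSeq A k = hA.eigenvalues₀ k := by
  rw [eigSeq, hA.sort_roots_charpoly_eq_eigenvalues₀]
  simp [List.getD]

theorem eigSeq_eigIndex (hA : A.IsHermitian) (i : n) : eigSeq A (eigIndex i) = hA.eigenvalues i :=
  eigSeq_fin hA _

theorem eigSeq_antitoneOn (hA : A.IsHermitian) :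
    AntitoneOn (eigSeq A) (Set.Iio (Fintype.card n)) := by
  intro k hk l hl hkl
  rw [eigSeq_fin hA ⟨k, hk⟩, eigSeq_fin hA ⟨l, hl⟩]
  exact hA.eigenvalues₀_antitone hkl

theorem eigSeq_nonneg (hA : A.PosSemidef) (k : ℕ) : 0 ≤ eigSeq A k := by
  rcases lt_or_ge k (Fintype.card n) with hk | hk
  · have h := eigSeq_eigIndex hA.isHermitian (eigIndex.symm ⟨k, hk⟩)
    rw [Equiv.apply_symm_apply] at h
    exact h ▸ hA.eigenvalues_nonneg _
  · rw [eigSeq_of_card_le A hk]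

theorem eigSeq_antitone (hA : A.PosSemidef) : Antitone (eigSeq A) := by
  intro k l hkl
  rcases lt_or_ge l (Fintype.card n) with hl | hl
  · exact eigSeq_antitoneOn hA.isHermitian (hkl.trans_lt hl) hl hkl
  · rw [eigSeq_of_card_le A hl]
    exact eigSeq_nonneg hA k

theorem exists_eq_conj_diagonal_eigSeq (hA : A.IsHermitian) :
    ∃ P : Matrix.unitaryGroup n ℂ,
      A = P.1 * Matrix.diagonal (fun i => (eigSeq A (eigIndex i) : ℂ)) * P.1ᴴ := by
  refine ⟨hA.eigenvectorUnitary, ?_⟩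
  simp_rw [eigSeq_eigIndex hA]
  exact hA.spectral_theorem

theorem eigSeq_conj (P : Matrix.unitaryGroup n ℂ) (A : Matrix n n ℂ) :
    eigSeq (P.1 * A * P.1ᴴ) = eigSeq A := by
  have hP : P.1ᴴ * P.1 = 1 := Matrix.mem_unitaryGroup_iff'.1 P.2
  funext k
  rw [eigSeq, Matrix.charpoly_mul_comm, ← Matrix.mul_assoc, hP, Matrix.one_mul, eigSeq]

theorem eigSeq_diagonal (e : n ≃ Fin (Fintype.card n)) {a : ℕ → ℝ} (ha : Antitone a) {k : ℕ}
    (hk : k < Fintype.card n) :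
    eigSeq (Matrix.diagonal fun i => (a (e i) : ℂ)) k = a k := by
  have hroots : (Matrix.diagonal fun i => (a (e i) : ℂ)).charpoly.roots.map RCLike.re =
      (List.ofFn fun j : Fin (Fintype.card n) => a j : Multiset ℝ) := by
    rw [Matrix.charpoly_diagonal, Polynomial.roots_prod _ _
        (Finset.prod_ne_zero_iff.2 fun i _ => Polynomial.X_sub_C_ne_zero _),
      ← Fin.univ_val_map, ← Finset.univ_map_equiv_to_embedding e, Finset.map_val,
      Multiset.map_map]
    simp
  have hsorted : (List.ofFn fun j : Fin (Fintype.card n) => a j).Pairwise (· ≥ ·) :=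
    List.pairwise_ofFn.2 fun i j hij => ha hij.le
  rw [eigSeq, hroots, Multiset.coe_sort, List.mergeSort_of_pairwise (by simpa using hsorted)]
  simp [List.getD, hk]

theorem eigSeq_transpose (A : Matrix n n ℂ) : eigSeq Aᵀ = eigSeq A := by
  funext k
  rw [eigSeq, Matrix.charpoly_transpose, eigSeq]

theorem eigSeq_mul_self (hA : A.PosSemidef) (k : ℕ) : eigSeq (A * A) k = eigSeq A k ^ 2 := by
  rcases lt_or_ge k (Fintype.card n) with hk | hk
  · obtain ⟨P, hP⟩ := exists_eq_conj_diagonal_eigSeq hA.isHermitian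
    have hPP : P.1ᴴ * P.1 = 1 := Matrix.mem_unitaryGroup_iff'.1 P.2
    have hsq : A * A =
        P.1 * Matrix.diagonal (fun i => ((eigSeq A (eigIndex i) ^ 2 : ℝ) : ℂ)) * P.1ᴴ := by
      conv_lhs => rw [hP]
      simp only [Matrix.mul_assoc]
      rw [← Matrix.mul_assoc P.1ᴴ, hPP, Matrix.one_mul, ← Matrix.mul_assoc (Matrix.diagonal _),
        Matrix.diagonal_mul_diagonal]
      simp [sq]
    rw [hsq, eigSeq_conj, eigSeq_diagonal (a := fun k => eigSeq A k ^ 2) eigIndex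
      (fun i j hij => pow_le_pow_left₀ (eigSeq_nonneg hA j) (eigSeq_antitone hA hij) 2) hk]
  · rw [eigSeq_of_card_le _ hk, eigSeq_of_card_le _ hk, zero_pow two_ne_zero]

theorem re_trace_eq_sum_eigSeq (hA : A.IsHermitian) :
    A.trace.re = ∑ k ∈ Finset.range (Fintype.card n), eigSeq A k := by
  rw [hA.trace_eq_sum_eigenvalues, ← sum_eigIndex (n := n), Complex.re_sum]
  exact Finset.sum_congr rfl fun i _ => by rw [eigSeq_eigIndex hA]; rfl

theorem re_trace_mul_self_eq_sum_eigSeq_sq (hA : A.PosSemidef) :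
    (A * A).trace.re = ∑ k ∈ Finset.range (Fintype.card n), eigSeq A k ^ 2 := by
  have hAA : (A * A).IsHermitian := by
    simpa [hA.isHermitian.eq] using Matrix.isHermitian_conjTranspose_mul_self A
  simp only [re_trace_eq_sum_eigSeq hAA, eigSeq_mul_self hA]

theorem getD_sort_add_replicate_zero {S : Multiset ℝ} (hS : ∀ x ∈ S, 0 ≤ x) (p k : ℕ) :
    ((S + Multiset.replicate p 0).sort (· ≥ ·)).getD k 0 = (S.sort (· ≥ ·)).getD k 0 := by
  have hsort : (S + Multiset.replicate p 0).sort (· ≥ ·) =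
      S.sort (· ≥ ·) ++ List.replicate p 0 := by
    refine List.Perm.eq_of_pairwise' (r := (· ≥ ·)) (Multiset.pairwise_sort _ _) ?_ ?_
    · refine List.pairwise_append.2 ⟨Multiset.pairwise_sort _ _,
        List.pairwise_replicate.2 (Or.inr le_rfl), fun x hx y hy => ?_⟩
      rw [List.eq_of_mem_replicate hy]
      exact hS x ((Multiset.mem_sort _).1 hx)
    · rw [← Multiset.coe_eq_coe, Multiset.sort_eq, ← Multiset.coe_add, Multiset.sort_eq,
        Multiset.coe_replicate]
  rw [hsort]
  rcases lt_or_ge k (S.sort (· ≥ ·)).length with hk | hk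
  · rw [List.getD_append _ _ _ _ hk]
  · rw [List.getD_append_right _ _ _ _ hk, List.getD_eq_default (S.sort (· ≥ ·)) _ hk]
    simp [List.getD, List.getElem?_replicate, apply_ite (Option.getD · (0 : ℝ))]

theorem re_roots_charpoly_nonneg (hA : A.PosSemidef) :
    ∀ x ∈ A.charpoly.roots.map RCLike.re, (0 : ℝ) ≤ x := by
  intro x hx
  rw [hA.isHermitian.roots_charpoly_eq_eigenvalues] at hx
  simp only [Multiset.map_map, Multiset.mem_map] at hx
  obtain ⟨i, -, rfl⟩ := hx
  simpa using hA.eigenvalues_nonneg i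

theorem eigSeq_conjTranspose_mul_self (X : Matrix m n ℂ) : eigSeq (Xᴴ * X) = eigSeq (X * Xᴴ) := by
  have hroots : (Xᴴ * X).charpoly.roots.map RCLike.re +
        Multiset.replicate (Fintype.card m) (0 : ℝ) =
      (X * Xᴴ).charpoly.roots.map RCLike.re + Multiset.replicate (Fintype.card n) (0 : ℝ) := by
    have h := congrArg (fun f : Polynomial ℂ => f.roots.map (RCLike.re : ℂ → ℝ))
      (Matrix.charpoly_mul_comm' X Xᴴ)
    have hX (p : ℕ) : (Polynomial.X ^ p : Polynomial ℂ) ≠ 0 := pow_ne_zero _ Polynomial.X_ne_zero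
    rw [Polynomial.roots_mul (mul_ne_zero (hX _) (Matrix.charpoly_monic _).ne_zero),
      Polynomial.roots_mul (mul_ne_zero (hX _) (Matrix.charpoly_monic _).ne_zero),
      Polynomial.roots_X_pow, Polynomial.roots_X_pow] at h
    simpa [Multiset.map_add, Multiset.nsmul_singleton, add_comm] using h.symm
  funext k
  rw [eigSeq, eigSeq, ← getD_sort_add_replicate_zero
      (re_roots_charpoly_nonneg (Matrix.posSemidef_conjTranspose_mul_self X)) (Fintype.card m),
    hroots, getD_sort_add_replicate_zero
      (re_roots_charpoly_nonneg (Matrix.posSemidef_self_mul_conjTranspose X))]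

end Spectrum

section TraceInequality

variable {n : Type*} [Fintype n] [DecidableEq n] {A B : Matrix n n ℂ}

theorem re_trace_diagonal_mul_conj_diagonal (X : Matrix n n ℂ) (a b : n → ℝ) :
    (Matrix.diagonal (fun i => (a i : ℂ)) *
      (X * Matrix.diagonal (fun i => (b i : ℂ)) * Xᴴ)).trace.re =
      ∑ i, ∑ j, a i * (Complex.normSq (X i j) * b j) := by
  rw [Matrix.trace, Complex.re_sum]
  refine Finset.sum_congr rfl fun i _ => ?_
  rw [Matrix.diag_apply, Matrix.diagonal_mul, Matrix.mul_apply, Finset.mul_sum, Complex.re_sum]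
  refine Finset.sum_congr rfl fun j _ => ?_
  have hterm : (a i : ℂ) * (X i j * (b j : ℂ) * star (X i j)) =
      ((a i * (Complex.normSq (X i j) * b j) : ℝ) : ℂ) := by
    push_cast
    rw [← Complex.mul_conj, Complex.star_def]
    ring
  rw [Matrix.mul_diagonal, Matrix.conjTranspose_apply, hterm, Complex.ofReal_re]

theorem normSq_unitary_mem_doublyStochastic (U : Matrix.unitaryGroup n ℂ) :
    (Matrix.of fun i j => Complex.normSq (U.1 i j)) ∈ doublyStochastic ℝ n := by
  rw [mem_doublyStochastic_iff_sum]
  refine ⟨fun i j => Complex.normSq_nonneg _, fun i => ?_, fun j => ?_⟩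
  · have h := congrArg Complex.re (congrFun₂ (Matrix.mem_unitaryGroup_iff.1 U.2) i i)
    simpa [Matrix.mul_apply, Matrix.star_apply, Complex.mul_conj] using h
  · have h := congrArg Complex.re (congrFun₂ (Matrix.mem_unitaryGroup_iff'.1 U.2) j j)
    simpa [Matrix.mul_apply, Matrix.star_apply, mul_comm, Complex.mul_conj] using h

theorem sum_permMatrix_mul (σ : Equiv.Perm n) (a b : n → ℝ) :
    ∑ i, ∑ j, a i * (σ.permMatrix ℝ i j * b j) = ∑ i, a i * b (σ i) := by
  simp [PEquiv.toMatrix_apply]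

theorem sum_mul_doublyStochastic_le {D : Matrix n n ℝ} (hD : D ∈ doublyStochastic ℝ n)
    {a b : n → ℝ} (hab : Monovary a b) :
    ∑ i, ∑ j, a i * (D i j * b j) ≤ ∑ i, a i * b i := by
  obtain ⟨w, hw0, hw1, rfl⟩ := exists_eq_sum_perm_of_mem_doublyStochastic hD
  calc ∑ i, ∑ j, a i * ((∑ σ, w σ • σ.permMatrix ℝ) i j * b j)
      = ∑ σ, w σ * ∑ i, ∑ j, a i * (σ.permMatrix ℝ i j * b j) := by
        simp only [Matrix.sum_apply, Matrix.smul_apply, smul_eq_mul, Finset.sum_mul, Finset.mul_sum]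
        rw [Finset.sum_congr rfl fun i _ => Finset.sum_comm, Finset.sum_comm]
        refine Finset.sum_congr rfl fun σ _ => Finset.sum_congr rfl fun i _ =>
          Finset.sum_congr rfl fun j _ => ?_
        ring
    _ ≤ ∑ σ, w σ * ∑ i, a i * b i := Finset.sum_le_sum fun σ _ => by
        rw [sum_permMatrix_mul]
        exact mul_le_mul_of_nonneg_left hab.sum_mul_comp_perm_le_sum_mul (hw0 σ)
    _ = ∑ i, a i * b i := by rw [← Finset.sum_mul, hw1, one_mul]

theorem isGreatest_re_trace_diagonal_mul_conj {a b : n → ℝ} (hab : Monovary a b) :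
    IsGreatest (Set.range fun U : Matrix.unitaryGroup n ℂ =>
      (Matrix.diagonal (fun i => (a i : ℂ)) *
        (U.1 * Matrix.diagonal (fun i => (b i : ℂ)) * U.1ᴴ)).trace.re) (∑ i, a i * b i) := by
  refine ⟨⟨1, ?_⟩, ?_⟩
  · simp [Matrix.diagonal_mul_diagonal, Matrix.trace_diagonal]
  · rintro _ ⟨U, rfl⟩
    exact (re_trace_diagonal_mul_conj_diagonal U.1 a b).trans_le <|
      sum_mul_doublyStochastic_le (normSq_unitary_mem_doublyStochastic U) hab

/-- **Von Neumann's trace theorem** for Hermitian matrices. -/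
theorem isGreatest_re_trace_mul_conj (hA : A.IsHermitian) (hB : B.IsHermitian) :
    IsGreatest (Set.range fun U : Matrix.unitaryGroup n ℂ => (A * (U.1 * B * U.1ᴴ)).trace.re)
      (∑ k ∈ Finset.range (Fintype.card n), eigSeq A k * eigSeq B k) := by
  obtain ⟨P, hP⟩ := exists_eq_conj_diagonal_eigSeq hA
  obtain ⟨Q, hQ⟩ := exists_eq_conj_diagonal_eigSeq hB
  have hmono : Monovary (fun i : n => eigSeq A (eigIndex i)) (fun i => eigSeq B (eigIndex i)) := by
    intro i j hij
    have hji : (eigIndex j : ℕ) ≤ eigIndex i := le_of_not_gt fun hlt =>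
      hij.not_ge (eigSeq_antitoneOn hB (eigIndex i).2 (eigIndex j).2 hlt.le)
    exact eigSeq_antitoneOn hA (eigIndex j).2 (eigIndex i).2 hji
  have hconj (U : Matrix.unitaryGroup n ℂ) : (A * (U.1 * B * U.1ᴴ)).trace.re =
      (Matrix.diagonal (fun i => (eigSeq A (eigIndex i) : ℂ)) *
        ((P⁻¹ * U * Q : Matrix.unitaryGroup n ℂ).1 *
          Matrix.diagonal (fun i => (eigSeq B (eigIndex i) : ℂ)) *
          (P⁻¹ * U * Q : Matrix.unitaryGroup n ℂ).1ᴴ)).trace.re := by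
    have hPUQ : (P⁻¹ * U * Q : Matrix.unitaryGroup n ℂ).1 = P.1ᴴ * U.1 * Q.1 := rfl
    conv_lhs => rw [hP, hQ]
    rw [hPUQ, Matrix.mul_assoc P.1, Matrix.mul_assoc P.1, Matrix.trace_mul_comm]
    simp only [Matrix.conjTranspose_mul, Matrix.conjTranspose_conjTranspose, Matrix.mul_assoc]
  have hsurj : Function.Surjective fun U : Matrix.unitaryGroup n ℂ => P⁻¹ * U * Q := fun W =>
    ⟨P * W * Q⁻¹, by group⟩
  simp only [hconj]
  rw [← sum_eigIndex (n := n) fun k => eigSeq A k * eigSeq B k]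
  have hrange := hsurj.range_comp fun W : Matrix.unitaryGroup n ℂ =>
    (Matrix.diagonal (fun i => (eigSeq A (eigIndex i) : ℂ)) *
      (W.1 * Matrix.diagonal (fun i => (eigSeq B (eigIndex i) : ℂ)) * W.1ᴴ)).trace.re
  exact hrange ▸ isGreatest_re_trace_diagonal_mul_conj hmono

end TraceInequality

section Continuity

variable {n X : Type*} [Fintype n] [DecidableEq n] [TopologicalSpace X] {F : X → Matrix n n ℂ}

theorem continuous_sum_mul_eigSeq (hF : Continuous F) (hH : ∀ x, (F x).IsHermitian) {d : ℕ → ℝ}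
    (hd : Antitone d) :
    Continuous fun x => ∑ k ∈ Finset.range (Fintype.card n), d k * eigSeq (F x) k := by
  have hD : (Matrix.diagonal fun i : n => (d (eigIndex i) : ℂ)).IsHermitian :=
    Matrix.isHermitian_diagonal_iff.2 fun i => by simp [IsSelfAdjoint]
  have hsup (x : X) : ∑ k ∈ Finset.range (Fintype.card n), d k * eigSeq (F x) k =
      sSup ((fun U : Matrix.unitaryGroup n ℂ =>
        (Matrix.diagonal (fun i : n => (d (eigIndex i) : ℂ)) *
          (U.1 * F x * U.1ᴴ)).trace.re) '' Set.univ) := by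
    rw [Set.image_univ, (isGreatest_re_trace_mul_conj hD (hH x)).csSup_eq]
    exact Finset.sum_congr rfl fun k hk => by
      rw [eigSeq_diagonal eigIndex hd (Finset.mem_range.1 hk)]
  simp_rw [hsup]
  refine isCompact_univ.continuous_sSup (Complex.continuous_re.comp (Continuous.matrix_trace ?_))
  have hU : Continuous fun p : X × Matrix.unitaryGroup n ℂ => p.2.1 :=
    continuous_subtype_val.comp continuous_snd
  exact continuous_const.matrix_mul
    ((hU.matrix_mul (hF.comp continuous_fst)).matrix_mul hU.matrix_conjTranspose)

/-- The `k`-th eigenvalue is the difference of two Ky Fan sums, those of the `k + 1` and of the `k`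
largest eigenvalues. -/
theorem continuous_eigSeq (hF : Continuous F) (hH : ∀ x, (F x).IsHermitian) (k : ℕ) :
    Continuous fun x => eigSeq (F x) k := by
  rcases lt_or_ge k (Fintype.card n) with hk | hk
  · have hanti (m : ℕ) : Antitone fun l : ℕ => if l < m then (1 : ℝ) else 0 :=
      fun a b hab => by dsimp only; grind
    have hdiff := (continuous_sum_mul_eigSeq hF hH (hanti (k + 1))).sub
      (continuous_sum_mul_eigSeq hF hH (hanti k))
    refine hdiff.congr fun x => ?_
    rw [Pi.sub_apply, ← Finset.sum_sub_distrib, Finset.sum_eq_single_of_mem k (by simpa using hk)]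
    · simp
    · intro l _ hl
      have : l < k + 1 ↔ l < k := by omega
      simp [this]
  · simp only [eigSeq_of_card_le _ hk, continuous_const]

end Continuity

section SwapOperator

variable {ι m n : Type*} [Fintype m] [DecidableEq m] [Fintype n] [DecidableEq n]

/-- The operator `x ⊗ y ↦ y ⊗ x` exchanging two tensor factors. -/
def swapOp (n : Type*) [DecidableEq n] : Matrix (n × n) (n × n) ℂ :=
  Equiv.Perm.permMatrix ℂ (Equiv.prodComm n n)

theorem swapOp_mul (M : Matrix (n × n) ι ℂ) : swapOp n * M = M.submatrix Prod.swap id :=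
  PEquiv.toMatrix_toPEquiv_mul _ _

theorem mul_swapOp (M : Matrix ι (n × n) ℂ) : M * swapOp n = M.submatrix id Prod.swap :=
  PEquiv.mul_toMatrix_toPEquiv _ _

theorem swapOp_mul_self : swapOp n * swapOp n = 1 := by
  rw [swapOp_mul]
  ext p q
  simp [swapOp, PEquiv.toMatrix_apply, Matrix.one_apply, Equiv.toPEquiv_apply]

theorem swapOp_mul_kronecker_self (A : Matrix m n ℂ) :
    swapOp m * (A ⊗ₖ A) = (A ⊗ₖ A) * swapOp n := by
  rw [swapOp_mul, mul_swapOp]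
  ext p q
  simp [mul_comm]

theorem trace_swapOp_mul_kronecker (A B : Matrix n n ℂ) :
    (swapOp n * (A ⊗ₖ B)).trace = (A * B).trace := by
  rw [swapOp_mul, Matrix.trace, Matrix.trace, Fintype.sum_prod_type, Finset.sum_comm]
  simp [Matrix.mul_apply]

theorem trace_swapOp : (swapOp n).trace = Fintype.card n := by
  simpa using trace_swapOp_mul_kronecker (1 : Matrix n n ℂ) 1

end SwapOperator

section Commutant

variable {n : Type*} [Fintype n] [DecidableEq n] {M : Matrix (n × n) (n × n) ℂ}

theorem apply_eq_zero_of_commute_diagonal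
    (hM : ∀ W : Matrix.unitaryGroup n ℂ, Commute (W.1 ⊗ₖ W.1) M) {p q : n × n}
    (hqp : q ≠ p) (hqp' : q ≠ p.swap) : M p q = 0 := by
  let phase (i j : n) : ℂ := if j = i then Complex.I else 1
  have hphase (i : n) : Matrix.diagonal (phase i) ∈ Matrix.unitaryGroup n ℂ := by
    rw [Matrix.mem_unitaryGroup_iff, Matrix.star_eq_conjTranspose, Matrix.diagonal_conjTranspose,
      Matrix.diagonal_mul_diagonal, ← Matrix.diagonal_one]
    congr 1
    ext j
    by_cases hj : j = i <;> simp [phase, hj]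
  have hcomm (i : n) : phase i p.1 * phase i p.2 * M p q = M p q * (phase i q.1 * phase i q.2) := by
    have h := congrFun₂ (hM ⟨_, hphase i⟩).eq p q
    rwa [Matrix.diagonal_kronecker_diagonal, Matrix.diagonal_mul, Matrix.mul_diagonal] at h
  by_contra hne
  have heq (i : n) : phase i p.1 * phase i p.2 = phase i q.1 * phase i q.2 :=
    mul_right_cancel₀ hne ((hcomm i).trans (mul_comm _ _))
  obtain ⟨a, c⟩ := p
  obtain ⟨b, d⟩ := q
  have ha := heq a
  have hc := heq c
  simp only [phase] at ha hc
  have hI1 : (Complex.I : ℂ) ≠ 1 := by simp [Complex.ext_iff]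
  have hI2 : (Complex.I : ℂ) * Complex.I = -1 := Complex.I_mul_I
  grind

theorem apply_perm_of_commute (hM : ∀ W : Matrix.unitaryGroup n ℂ, Commute (W.1 ⊗ₖ W.1) M)
    (σ : Equiv.Perm n) (p q : n × n) : M (p.map σ σ) (q.map σ σ) = M p q := by
  have hσ : σ.permMatrix ℂ ∈ Matrix.unitaryGroup n ℂ := by
    rw [Matrix.mem_unitaryGroup_iff, Matrix.star_eq_conjTranspose, Matrix.conjTranspose_permMatrix,
      ← Matrix.permMatrix_mul, inv_mul_cancel, Matrix.permMatrix_one]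
  have h := congrFun₂ (hM ⟨_, hσ⟩).eq p (q.map σ σ)
  simpa [Matrix.mul_apply, Fintype.sum_prod_type, PEquiv.toMatrix_apply, Equiv.toPEquiv_apply,
    ite_and, Prod.map] using h

/-- For a reflection `H` the matrix `z + w H` with `z = (1 + i)/2` and `w = (1 - i)/2` is unitary
(it is a square root of `H`), and the part of its tensor square that is not a multiple of `1` or of
`H ⊗ H` is `zw (1 ⊗ H + H ⊗ 1)`. -/
theorem commute_one_kronecker_add_kronecker_one
    (hM : ∀ W : Matrix.unitaryGroup n ℂ, Commute (W.1 ⊗ₖ W.1) M) {H : Matrix n n ℂ}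
    (hH : H.IsHermitian) (hHH : H * H = 1) :
    Commute ((1 : Matrix n n ℂ) ⊗ₖ H + H ⊗ₖ (1 : Matrix n n ℂ)) M := by
  set z : ℂ := (1 + Complex.I) / 2
  set w : ℂ := (1 - Complex.I) / 2
  have hI : Complex.I * Complex.I = -1 := Complex.I_mul_I
  have hzw : z * w = 1 / 2 := by grind
  have hzz : z * z + w * w = 0 := by grind
  have hz : star z = w := by simp [z, w, sub_eq_add_neg]
  have hw : star w = z := by rw [← hz, star_star]
  have hmemH : H ∈ Matrix.unitaryGroup n ℂ := by
    rw [Matrix.mem_unitaryGroup_iff, Matrix.star_eq_conjTranspose, hH.eq, hHH]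
  have hmem : z • 1 + w • H ∈ Matrix.unitaryGroup n ℂ := by
    rw [Matrix.mem_unitaryGroup_iff, star_add, star_smul, star_smul, star_one,
      Matrix.star_eq_conjTranspose, hH.eq, hz, hw]
    calc (z • 1 + w • H) * (w • 1 + z • H)
        = (z * w) • (1 : Matrix n n ℂ) + (z * w) • (H * H) + (z * z + w * w) • H := by
          simp only [add_mul, mul_add, smul_mul_smul_comm, one_mul, mul_one]
          module
      _ = 1 := by rw [hHH, hzz, hzw]; module
  have hsplit : (1 : Matrix n n ℂ) ⊗ₖ H + H ⊗ₖ (1 : Matrix n n ℂ) =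
      (2 : ℂ) • ((z • 1 + w • H) ⊗ₖ (z • 1 + w • H)) - (2 * (z * z)) • 1 -
        (2 * (w * w)) • (H ⊗ₖ H) := by
    simp only [Matrix.add_kronecker, Matrix.kronecker_add, Matrix.smul_kronecker,
      Matrix.kronecker_smul, Matrix.one_kronecker_one]
    match_scalars <;> grind
  rw [hsplit]
  exact (((hM ⟨_, hmem⟩).smul_left _).sub_left ((Commute.one_left M).smul_left _)).sub_left
    ((hM ⟨_, hmemH⟩).smul_left _)

theorem apply_diag_of_commute (hM : ∀ W : Matrix.unitaryGroup n ℂ, Commute (W.1 ⊗ₖ W.1) M)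
    {a c : n} (hac : a ≠ c) : M (a, a) (a, a) = M (a, c) (a, c) + M (a, c) (c, a) := by
  have hH : (Matrix.swap ℂ a c).IsHermitian := Matrix.conjTranspose_swap a c
  have h := congrFun₂ (commute_one_kronecker_add_kronecker_one hM hH
    (Matrix.swap_mul_self a c)).eq (a, a) (a, c)
  have h0 : M (a, a) (c, c) = 0 := apply_eq_zero_of_commute_diagonal hM (by grind) (by grind)
  have hswap : M (c, a) (a, c) = M (a, c) (c, a) := by
    simpa using apply_perm_of_commute hM (Equiv.swap a c) (a, c) (c, a)
  have hentry : M (a, c) (a, c) + M (c, a) (a, c) = M (a, a) (a, a) + M (a, a) (c, c) := by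
    simpa [Matrix.mul_apply, add_mul, mul_add, Finset.sum_add_distrib, Fintype.sum_prod_type,
      Matrix.swap, PEquiv.toMatrix_apply, Equiv.toPEquiv_apply, Equiv.swap_apply_eq_iff,
      Matrix.one_apply] using h
  rw [← hswap, hentry, h0, add_zero]

/-- **Schur–Weyl duality** for two tensor factors. -/
theorem exists_eq_smul_one_add_smul_swapOp [Nontrivial n]
    (hM : ∀ W : Matrix.unitaryGroup n ℂ, Commute (W.1 ⊗ₖ W.1) M) :
    ∃ x y : ℂ, M = x • 1 + y • swapOp n := by
  obtain ⟨a₀, c₀, h₀⟩ := exists_pair_ne n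
  refine ⟨M (a₀, c₀) (a₀, c₀), M (a₀, c₀) (c₀, a₀), ?_⟩
  have htrans {a c : n} (hac : a ≠ c) : M (a, c) (a, c) = M (a₀, c₀) (a₀, c₀) ∧
      M (a, c) (c, a) = M (a₀, c₀) (c₀, a₀) := by
    obtain ⟨σ, rfl, rfl⟩ := MulAction.is_two_pretransitive_iff.1
      (Equiv.Perm.isMultiplyPretransitive n 2) h₀ hac
    exact ⟨apply_perm_of_commute hM σ (a₀, c₀) (a₀, c₀),
      apply_perm_of_commute hM σ (a₀, c₀) (c₀, a₀)⟩
  ext ⟨a, c⟩ q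
  have hrhs : (M (a₀, c₀) (a₀, c₀) • 1 + M (a₀, c₀) (c₀, a₀) • swapOp n :
      Matrix (n × n) (n × n) ℂ) (a, c) q =
        (if q = (a, c) then M (a₀, c₀) (a₀, c₀) else 0) +
          (if q = (c, a) then M (a₀, c₀) (c₀, a₀) else 0) := by
    simp [swapOp, PEquiv.toMatrix_apply, Equiv.toPEquiv_apply, Matrix.one_apply, eq_comm]
  rw [hrhs]
  by_cases hq : q = (a, c)
  · subst hq
    by_cases hac : a = c
    · subst hac
      obtain ⟨c, hc⟩ := exists_ne a
      simp [apply_diag_of_commute hM hc.symm, htrans hc.symm]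
    · simp [htrans hac, hac]
  · by_cases hq' : q = (c, a)
    · subst hq'
      have hac : a ≠ c := fun h => hq (by rw [h])
      simp [htrans hac, hac.symm]
    · simp [hq, hq', apply_eq_zero_of_commute_diagonal hM (p := (a, c)) hq hq']

end Commutant

section HaarTwirl

variable {m n p q : Type*} [Fintype n] [DecidableEq n]

instance isMulLeftInvariant_haarUnitary : (haarUnitary n).IsMulLeftInvariant := by
  unfold haarUnitary
  infer_instance

theorem integrable_haarUnitary {E : Type*} [NormedAddCommGroup E]
    {f : Matrix.unitaryGroup n ℂ → E} (hf : Continuous f) : Integrable f (haarUnitary n) :=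
  hf.integrable_of_hasCompactSupport (HasCompactSupport.of_compactSpace f)

/-- The entrywise Haar average of a matrix-valued function on the unitary group. -/
noncomputable def haarMean (f : Matrix.unitaryGroup n ℂ → Matrix p q ℂ) : Matrix p q ℂ :=
  Matrix.of fun i j => ∫ U, f U i j ∂haarUnitary n

theorem haarMean_mul_left (W : Matrix.unitaryGroup n ℂ)
    (f : Matrix.unitaryGroup n ℂ → Matrix p q ℂ) : haarMean (fun U => f (W * U)) = haarMean f := by
  ext i j
  exact integral_mul_left_eq_self (fun U => f U i j) W

theorem haarMean_const_mul [Fintype p] (A : Matrix m p ℂ)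
    {f : Matrix.unitaryGroup n ℂ → Matrix p q ℂ} (hf : Continuous f) :
    haarMean (fun U => A * f U) = A * haarMean f := by
  ext i j
  simp only [haarMean, Matrix.of_apply, Matrix.mul_apply]
  rw [integral_finsetSum _ fun k _ => (integrable_haarUnitary (hf.matrix_elem k j)).const_mul _]
  exact Finset.sum_congr rfl fun k _ => integral_const_mul _ _

theorem haarMean_mul_const [Fintype q] {f : Matrix.unitaryGroup n ℂ → Matrix p q ℂ}
    (hf : Continuous f) (A : Matrix q m ℂ) : haarMean (fun U => f U * A) = haarMean f * A := by
  ext i j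
  simp only [haarMean, Matrix.of_apply, Matrix.mul_apply]
  rw [integral_finsetSum _ fun k _ => (integrable_haarUnitary (hf.matrix_elem i k)).mul_const _]
  exact Finset.sum_congr rfl fun k _ => integral_mul_const _ _

theorem trace_haarMean [Fintype p] {f : Matrix.unitaryGroup n ℂ → Matrix p p ℂ}
    (hf : Continuous f) : (haarMean f).trace = ∫ U, (f U).trace ∂haarUnitary n :=
  (integral_finsetSum _ fun k _ => integrable_haarUnitary (hf.matrix_elem k k)).symm

/-- The twirl `X ↦ 𝔼 (U ⊗ U) X (U ⊗ U)*` over the unitary group. -/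
noncomputable def haarTwirl (X : Matrix (n × n) (n × n) ℂ) : Matrix (n × n) (n × n) ℂ :=
  haarMean fun U : Matrix.unitaryGroup n ℂ => (U.1 ⊗ₖ U.1) * X * (U.1 ⊗ₖ U.1)ᴴ

theorem continuous_kronecker_self_conj (X : Matrix (n × n) (n × n) ℂ) :
    Continuous fun U : Matrix.unitaryGroup n ℂ => (U.1 ⊗ₖ U.1) * X * (U.1 ⊗ₖ U.1)ᴴ := by
  have hU : Continuous fun U : Matrix.unitaryGroup n ℂ => U.1 ⊗ₖ U.1 :=
    continuous_matrix fun i j => (continuous_subtype_val.matrix_elem _ _).mul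
      (continuous_subtype_val.matrix_elem _ _)
  exact (hU.matrix_mul continuous_const).matrix_mul hU.matrix_conjTranspose

theorem trace_mul_haarTwirl (A X : Matrix (n × n) (n × n) ℂ) :
    (A * haarTwirl X).trace =
      ∫ U : Matrix.unitaryGroup n ℂ, (A * ((U.1 ⊗ₖ U.1) * X * (U.1 ⊗ₖ U.1)ᴴ)).trace
        ∂haarUnitary n := by
  have hcont := continuous_kronecker_self_conj X
  rw [haarTwirl, ← haarMean_const_mul A hcont, trace_haarMean (continuous_const.matrix_mul hcont)]

theorem trace_mul_haarTwirl_of_commute {A : Matrix (n × n) (n × n) ℂ}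
    (hA : ∀ W : Matrix.unitaryGroup n ℂ, Commute (W.1 ⊗ₖ W.1) A) (X : Matrix (n × n) (n × n) ℂ) :
    (A * haarTwirl X).trace = (A * X).trace := by
  have hconst (U : Matrix.unitaryGroup n ℂ) :
      (A * ((U.1 ⊗ₖ U.1) * X * (U.1 ⊗ₖ U.1)ᴴ)).trace = (A * X).trace := by
    have hU : (U.1 ⊗ₖ U.1)ᴴ * (U.1 ⊗ₖ U.1) = 1 :=
      Matrix.mem_unitaryGroup_iff'.1 (Matrix.kronecker_mem_unitary U.2 U.2)
    rw [← Matrix.mul_assoc, ← Matrix.mul_assoc, ← (hA U).eq, Matrix.trace_mul_comm,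
      ← Matrix.mul_assoc, ← Matrix.mul_assoc, hU, Matrix.one_mul]
  simp [trace_mul_haarTwirl, hconst]

theorem commute_haarTwirl (W : Matrix.unitaryGroup n ℂ) (X : Matrix (n × n) (n × n) ℂ) :
    Commute (W.1 ⊗ₖ W.1) (haarTwirl X) := by
  have hW : (W.1 ⊗ₖ W.1)ᴴ * (W.1 ⊗ₖ W.1) = 1 :=
    Matrix.mem_unitaryGroup_iff'.1 (Matrix.kronecker_mem_unitary W.2 W.2)
  have hcont := continuous_kronecker_self_conj X
  have hinv : (W.1 ⊗ₖ W.1) * haarTwirl X * (W.1 ⊗ₖ W.1)ᴴ = haarTwirl X := by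
    rw [haarTwirl, ← haarMean_const_mul _ hcont,
      ← haarMean_mul_const (continuous_const.matrix_mul hcont)]
    refine Eq.trans (congrArg haarMean ?_) (haarMean_mul_left W _)
    funext U
    simp only [Submonoid.coe_mul, Matrix.mul_kronecker_mul, Matrix.conjTranspose_mul,
      Matrix.mul_assoc]
  rw [Commute, SemiconjBy]
  conv_rhs => rw [← hinv, Matrix.mul_assoc, hW, Matrix.mul_one]

theorem haarTwirl_eq [Nontrivial n] (X : Matrix (n × n) (n × n) ℂ) :
    haarTwirl X =
      ((Fintype.card n * X.trace - (swapOp n * X).trace) /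
        (Fintype.card n * ((Fintype.card n : ℂ) ^ 2 - 1))) • 1 +
      ((Fintype.card n * (swapOp n * X).trace - X.trace) /
        (Fintype.card n * ((Fintype.card n : ℂ) ^ 2 - 1))) • swapOp n := by
  obtain ⟨x, y, hxy⟩ := exists_eq_smul_one_add_smul_swapOp fun W => commute_haarTwirl W X
  have htrace : X.trace = x * Fintype.card n ^ 2 + y * Fintype.card n := by
    have h := trace_mul_haarTwirl_of_commute (fun W => Commute.one_right (W.1 ⊗ₖ W.1)) X
    rw [Matrix.one_mul, Matrix.one_mul, hxy] at h
    simp [← h, trace_swapOp, sq]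
  have hswap : (swapOp n * X).trace = x * Fintype.card n + y * Fintype.card n ^ 2 := by
    have h := trace_mul_haarTwirl_of_commute (fun W => (swapOp_mul_kronecker_self W.1).symm) X
    rw [hxy, Matrix.mul_add, Matrix.mul_smul, Matrix.mul_smul, Matrix.mul_one,
      swapOp_mul_self] at h
    simp [← h, trace_swapOp, sq]
  have hcard : (Fintype.card n : ℂ) * ((Fintype.card n : ℂ) ^ 2 - 1) ≠ 0 := by
    have h1 := Fintype.one_lt_card (α := n)
    refine mul_ne_zero (by simp) (sub_ne_zero.2 ?_)
    exact_mod_cast (Nat.one_lt_pow two_ne_zero h1).ne'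
  rw [hxy, htrace, hswap]
  congr 2 <;> rw [eq_div_iff hcard] <;> ring

end HaarTwirl

section HilbertSchmidt

variable {α β : Type*} [Fintype α] [Fintype β]

theorem hsNormSq_eq_sum_normSq (M : Matrix α α ℂ) :
    hsNormSq M = ∑ i, ∑ j, Complex.normSq (M j i) := by
  simp [hsNormSq, Matrix.trace, Matrix.mul_apply, Complex.normSq_apply]

theorem hsNormSq_eq_re_trace_mul_self {M : Matrix α α ℂ} (hM : M.IsHermitian) :
    hsNormSq M = (M * M).trace.re := by
  rw [hsNormSq, hM.eq]

theorem hsNormSq_kronecker (A : Matrix α α ℂ) (B : Matrix β β ℂ) :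
    hsNormSq (A ⊗ₖ B) = hsNormSq A * hsNormSq B := by
  simp only [hsNormSq_eq_sum_normSq, Fintype.sum_prod_type, Matrix.kroneckerMap_apply,
    Complex.normSq_mul, ← Finset.mul_sum, ← Finset.sum_mul]

theorem hsNormSq_vecMulVec_star (w : α → ℂ) :
    hsNormSq (Matrix.vecMulVec w (star w)) = (star w ⬝ᵥ w).re ^ 2 := by
  have hw : (star w ⬝ᵥ w).re = ∑ i, Complex.normSq (w i) := by
    simp [dotProduct, Complex.normSq_apply]
  simp only [hsNormSq_eq_sum_normSq, Matrix.vecMulVec_apply, Complex.normSq_mul, Pi.star_apply,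
    Complex.star_def, Complex.normSq_conj, ← Finset.mul_sum, ← Finset.sum_mul, hw, sq]

theorem hsNormSq_sub_vecMulVec_star {A : Matrix α α ℂ} (hA : A.IsHermitian) (w : α → ℂ) :
    hsNormSq (A - Matrix.vecMulVec w (star w)) =
      hsNormSq A + (star w ⬝ᵥ w).re ^ 2 - 2 * (star w ⬝ᵥ A *ᵥ w).re := by
  have hcross : (A * Matrix.vecMulVec w (star w)).trace = star w ⬝ᵥ A *ᵥ w := by
    rw [Matrix.mul_vecMulVec, Matrix.trace_vecMulVec, dotProduct_comm]
  rw [← hsNormSq_vecMulVec_star, hsNormSq, hsNormSq, hsNormSq, Matrix.conjTranspose_sub,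
    Matrix.conjTranspose_vecMulVec, star_star, hA.eq, sub_mul, mul_sub, mul_sub]
  simp only [Matrix.trace_sub, Complex.sub_re,
    Matrix.trace_mul_comm (Matrix.vecMulVec w (star w)) A, hcross]
  ring

theorem hsNormSq_eq_sum_eigSeq_sq [DecidableEq α] {A : Matrix α α ℂ} (hA : A.PosSemidef) :
    hsNormSq A = ∑ k ∈ Finset.range (Fintype.card α), eigSeq A k ^ 2 := by
  rw [hsNormSq_eq_re_trace_mul_self hA.isHermitian, re_trace_mul_self_eq_sum_eigSeq_sq hA]

end HilbertSchmidt

section Purification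

variable {dI dO dE : ℕ} {ρ : Matrix (Fin dE) (Fin dE) ℂ}

/-- The Choi vector of `V` regarded as an operator from `H_I ⊗ H_O` to the environment, so that
`choiVec V` is its vectorization. -/
def envMat (V : Matrix (Fin dO × Fin dE) (Fin dI) ℂ) : Matrix (Fin dE) (Fin dI × Fin dO) ℂ :=
  Matrix.of fun e p => choiVec V (p, e)

/-- The partial trace of `|V⟩⟨V|` over `H_I ⊗ H_O`, that is, the reduced operator of the Choi vector
on the environment. -/
def envOp (V : Matrix (Fin dO × Fin dE) (Fin dI) ℂ) : Matrix (Fin dE) (Fin dE) ℂ :=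
  envMat V * (envMat V)ᴴ

theorem choiVec_eq_vec (V : Matrix (Fin dO × Fin dE) (Fin dI) ℂ) :
    choiVec V = (envMat V).vec := rfl

theorem choiOp_eq_transpose (V : Matrix (Fin dO × Fin dE) (Fin dI) ℂ) :
    choiOp V = ((envMat V)ᴴ * envMat V)ᵀ := by
  ext p q
  simp [choiOp, partialTraceRight, choiProj, Matrix.vecMulVec_apply, Matrix.mul_apply, envMat,
    mul_comm]

theorem choiOp_posSemidef (V : Matrix (Fin dO × Fin dE) (Fin dI) ℂ) : (choiOp V).PosSemidef := by
  rw [choiOp_eq_transpose]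
  exact (Matrix.posSemidef_conjTranspose_mul_self _).transpose

theorem envOp_posSemidef (V : Matrix (Fin dO × Fin dE) (Fin dI) ℂ) : (envOp V).PosSemidef :=
  Matrix.posSemidef_self_mul_conjTranspose _

theorem eigSeq_envOp (V : Matrix (Fin dO × Fin dE) (Fin dI) ℂ) :
    eigSeq (envOp V) = eigSeq (choiOp V) := by
  rw [choiOp_eq_transpose, eigSeq_transpose, eigSeq_conjTranspose_mul_self, envOp]

theorem eigSeq_choiOp_of_le (V : Matrix (Fin dO × Fin dE) (Fin dI) ℂ) {k : ℕ} (hk : dE ≤ k) :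
    eigSeq (choiOp V) k = 0 := by
  rw [← eigSeq_envOp]
  exact eigSeq_of_card_le _ (by simpa using hk)

theorem orderedEig_eq_eigSeq (V : Matrix (Fin dO × Fin dE) (Fin dI) ℂ)
    (i : Fin (Fintype.card (Fin dI × Fin dO))) : orderedEig V i = eigSeq (choiOp V) i :=
  (eigSeq_fin _ i).symm

theorem trace_choiOp (V : Matrix (Fin dO × Fin dE) (Fin dI) ℂ) :
    (choiOp V).trace = (Vᴴ * V).trace := by
  simp [choiOp, partialTraceRight, choiProj, choiVec, Matrix.trace, Matrix.mul_apply,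
    Matrix.vecMulVec_apply, Fintype.sum_prod_type, mul_comm]

theorem purity_eq_re_trace_envOp (V : Matrix (Fin dO × Fin dE) (Fin dI) ℂ) :
    purity V = (envOp V * envOp V).trace.re := by
  rw [purity, choiOp_eq_transpose, ← Matrix.transpose_mul, Matrix.trace_transpose, Matrix.mul_assoc,
    Matrix.trace_mul_comm, envOp]
  simp only [Matrix.mul_assoc]

theorem purity_eq_sum_eigSeq_sq (V : Matrix (Fin dO × Fin dE) (Fin dI) ℂ) :
    purity V = ∑ k ∈ Finset.range dE, eigSeq (choiOp V) k ^ 2 := by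
  rw [purity_eq_re_trace_envOp, re_trace_mul_self_eq_sum_eigSeq_sq (envOp_posSemidef V),
    Fintype.card_fin, eigSeq_envOp]

theorem rotatedProj_eq (V : Matrix (Fin dO × Fin dE) (Fin dI) ℂ)
    (U : Matrix.unitaryGroup (Fin dE) ℂ) :
    rotatedProj V U =
      Matrix.vecMulVec (U.1 * envMat V).vec (star (U.1 * envMat V).vec) := by
  have hvec : ((1 : Matrix (Fin dI × Fin dO) (Fin dI × Fin dO) ℂ) ⊗ₖ U.1) *ᵥ choiVec V =
      (U.1 * envMat V).vec := by
    rw [choiVec_eq_vec, Matrix.kronecker_mulVec_vec, Matrix.transpose_one, Matrix.mul_one]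
  rw [rotatedProj, choiProj, Matrix.mul_vecMulVec, Matrix.vecMulVec_mul, ← Matrix.star_mulVec, hvec]

theorem dist2_eq (hρ : ρ.IsHermitian) (V : Matrix (Fin dO × Fin dE) (Fin dI) ℂ)
    (U : Matrix.unitaryGroup (Fin dE) ℂ) :
    dist2 ρ V U = purity V * hsNormSq ρ + (Vᴴ * V).trace.re ^ 2 -
      2 * (ρ * (U.1 * (envOp V * envOp V) * U.1ᴴ)).trace.re := by
  set X := envMat V with hX
  have hU : U.1ᴴ * U.1 = 1 := Matrix.mem_unitaryGroup_iff'.1 U.2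
  have hnorm : star (U.1 * X).vec ⬝ᵥ (U.1 * X).vec = (Vᴴ * V).trace := by
    rw [Matrix.star_vec_dotProduct_vec, Matrix.conjTranspose_mul, Matrix.mul_assoc,
      ← Matrix.mul_assoc U.1ᴴ, hU, Matrix.one_mul, ← Matrix.trace_transpose, ← trace_choiOp,
      choiOp_eq_transpose]
  have hcross : star (U.1 * X).vec ⬝ᵥ (choiOp V ⊗ₖ ρ) *ᵥ (U.1 * X).vec =
      (ρ * (U.1 * (envOp V * envOp V) * U.1ᴴ)).trace := by
    rw [Matrix.kronecker_mulVec_vec, Matrix.star_vec_dotProduct_vec, choiOp_eq_transpose,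
      Matrix.transpose_transpose, Matrix.trace_mul_comm, Matrix.conjTranspose_mul, envOp, ← hX]
    simp only [Matrix.mul_assoc]
  have hherm : (choiOp V ⊗ₖ ρ).IsHermitian := by
    rw [Matrix.IsHermitian, Matrix.conjTranspose_kronecker, hρ.eq, (choiOp_isHermitian V).eq]
  rw [dist2, appendEnv, rotatedProj_eq, hsNormSq_sub_vecMulVec_star hherm, hsNormSq_kronecker,
    hsNormSq_eq_re_trace_mul_self (choiOp_isHermitian V), hnorm, hcross, purity]

/-- Only the term `tr (ρ U σ² U*)`, where `σ` is the reduced operator of the Choi vector on the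
environment, depends on `U`; von Neumann's trace theorem maximizes it. -/
theorem isLeast_dist2 (hρ : ρ.PosSemidef) (V : Matrix (Fin dO × Fin dE) (Fin dI) ℂ) :
    IsLeast (Set.range (dist2 ρ V))
      (purity V * ∑ k ∈ Finset.range dE, eigSeq ρ k ^ 2 + (Vᴴ * V).trace.re ^ 2 -
        2 * ∑ k ∈ Finset.range dE, eigSeq ρ k * eigSeq (choiOp V) k ^ 2) := by
  have henv : (envOp V * envOp V).IsHermitian := by
    simpa [(envOp_posSemidef V).isHermitian.eq] using
      Matrix.isHermitian_conjTranspose_mul_self (envOp V)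
  obtain ⟨⟨U₀, hU₀⟩, hmax⟩ := isGreatest_re_trace_mul_conj hρ.isHermitian henv
  simp only [eigSeq_mul_self (envOp_posSemidef V), eigSeq_envOp, Fintype.card_fin] at hU₀ hmax
  have hsq := hsNormSq_eq_sum_eigSeq_sq hρ
  rw [Fintype.card_fin] at hsq
  rw [← hsq]
  refine ⟨⟨U₀, by rw [dist2_eq hρ.isHermitian, hU₀]⟩, ?_⟩
  rintro _ ⟨U, rfl⟩
  rw [dist2_eq hρ.isHermitian]
  linarith [hmax ⟨U, rfl⟩]

theorem bestDist2_eq (hρ : ρ.PosSemidef) (V : Matrix (Fin dO × Fin dE) (Fin dI) ℂ) :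
    bestDist2 ρ V = purity V * ∑ k ∈ Finset.range dE, eigSeq ρ k ^ 2 + (Vᴴ * V).trace.re ^ 2 -
      2 * ∑ k ∈ Finset.range dE, eigSeq ρ k * eigSeq (choiOp V) k ^ 2 :=
  (isLeast_dist2 hρ V).csInf_eq

theorem isLeast_bestDist2 (hρ : ρ.PosSemidef) (V : Matrix (Fin dO × Fin dE) (Fin dI) ℂ) :
    IsLeast (Set.range (dist2 ρ V)) (bestDist2 ρ V) :=
  bestDist2_eq hρ V ▸ isLeast_dist2 hρ V

end Purification

section PartialTrace

variable {α β : Type*} [Fintype α] [Fintype β]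

/-- The partial trace over the first tensor factor. -/
def partialTraceLeft (M : Matrix (α × β) (α × β) ℂ) : Matrix β β ℂ :=
  Matrix.of fun e f => ∑ a, M (a, e) (a, f)

variable [DecidableEq α] [DecidableEq β]

/-- The operator on `(α ⊗ β) ⊗ (α ⊗ β)` exchanging the two factors `β`. -/
def rightSwapOp (α β : Type*) [DecidableEq α] [DecidableEq β] :
    Matrix ((α × β) × (α × β)) ((α × β) × (α × β)) ℂ :=
  Equiv.Perm.permMatrix ℂ <| Function.Involutive.toPerm
    (fun x => ((x.1.1, x.2.2), (x.2.1, x.1.2))) fun _ => rfl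

theorem trace_rightSwapOp_mul (M : Matrix ((α × β) × (α × β)) ((α × β) × (α × β)) ℂ) :
    (rightSwapOp α β * M).trace = ∑ a, ∑ e, ∑ b, ∑ f, M ((a, f), (b, e)) ((a, e), (b, f)) := by
  have hmul : rightSwapOp α β * M =
      M.submatrix (fun x => ((x.1.1, x.2.2), (x.2.1, x.1.2))) id :=
    PEquiv.toMatrix_toPEquiv_mul _ _
  simp only [hmul, Matrix.trace, Matrix.diag_apply, Matrix.submatrix_apply, id,
    Fintype.sum_prod_type]

theorem trace_rightSwapOp_mul_kronecker (A B : Matrix (α × β) (α × β) ℂ) :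
    (rightSwapOp α β * (A ⊗ₖ B)).trace = (partialTraceLeft A * partialTraceLeft B).trace := by
  rw [trace_rightSwapOp_mul]
  simp only [Matrix.trace, Matrix.diag_apply, Matrix.mul_apply, partialTraceLeft, Matrix.of_apply,
    Matrix.kroneckerMap_apply, Finset.sum_mul_sum]
  rw [Finset.sum_comm (f := fun e f => ∑ a, ∑ b, A (a, e) (a, f) * B (b, f) (b, e)),
    Finset.sum_comm]
  exact Finset.sum_congr rfl fun e _ => Finset.sum_comm_cycle

theorem trace_rightSwapOp :
    (rightSwapOp α β).trace = (Fintype.card α : ℂ) ^ 2 * Fintype.card β := by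
  rw [← Matrix.mul_one (rightSwapOp α β), trace_rightSwapOp_mul]
  simp [Matrix.one_apply, ite_and, sq, mul_assoc, mul_comm]

theorem trace_rightSwapOp_mul_swapOp :
    (rightSwapOp α β * swapOp (α × β)).trace = Fintype.card α * (Fintype.card β : ℂ) ^ 2 := by
  rw [trace_rightSwapOp_mul]
  simp [swapOp, PEquiv.toMatrix_apply, Equiv.toPEquiv_apply, @eq_comm α, sq]

end PartialTrace

section AveragePurity

variable {dI dO dE : ℕ}

theorem envOp_eq_partialTraceLeft (V : Matrix (Fin dO × Fin dE) (Fin dI) ℂ) :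
    envOp V = partialTraceLeft (V * Vᴴ) := by
  ext e f
  simp only [envOp, envMat, choiVec, partialTraceLeft, Matrix.mul_apply, Matrix.of_apply,
    Matrix.conjTranspose_apply, Fintype.sum_prod_type]
  exact Finset.sum_comm

theorem purity_unitary_mul (U : Matrix.unitaryGroup (Fin dO × Fin dE) ℂ)
    (V : Matrix (Fin dO × Fin dE) (Fin dI) ℂ) :
    purity (U.1 * V) = (rightSwapOp (Fin dO) (Fin dE) *
      ((U.1 ⊗ₖ U.1) * ((V * Vᴴ) ⊗ₖ (V * Vᴴ)) * (U.1 ⊗ₖ U.1)ᴴ)).trace.re := by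
  rw [Matrix.conjTranspose_kronecker, ← Matrix.mul_kronecker_mul, ← Matrix.mul_kronecker_mul,
    trace_rightSwapOp_mul_kronecker, purity_eq_re_trace_envOp, envOp_eq_partialTraceLeft,
    Matrix.conjTranspose_mul]
  simp only [Matrix.mul_assoc]

theorem integral_purity_unitary_mul (V : Matrix (Fin dO × Fin dE) (Fin dI) ℂ) :
    ∫ U : Matrix.unitaryGroup (Fin dO × Fin dE) ℂ, purity (U.1 * V) ∂haarUnitary _ =
      (rightSwapOp (Fin dO) (Fin dE) * haarTwirl ((V * Vᴴ) ⊗ₖ (V * Vᴴ))).trace.re := by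
  simp only [trace_mul_haarTwirl, purity_unitary_mul]
  exact integral_re (integrable_haarUnitary
    (continuous_const.matrix_mul (continuous_kronecker_self_conj _)).matrix_trace)

theorem integral_purity_of_isometry (hN : 2 ≤ dO * dE) {V : Matrix (Fin dO × Fin dE) (Fin dI) ℂ}
    (hV : Vᴴ * V = 1) :
    ∫ U : Matrix.unitaryGroup (Fin dO × Fin dE) ℂ, purity (U.1 * V) ∂haarUnitary _ =
      ((dI : ℝ) * dO * ((dE : ℝ) ^ 2 - 1) + (dI : ℝ) ^ 2 * dE * ((dO : ℝ) ^ 2 - 1)) /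
        ((dO : ℝ) ^ 2 * (dE : ℝ) ^ 2 - 1) := by
  have hcard : Fintype.card (Fin dO × Fin dE) = dO * dE := by simp
  have : Nontrivial (Fin dO × Fin dE) := Fintype.one_lt_card_iff_nontrivial.1 (by omega)
  have htr : (V * Vᴴ).trace = dI := by
    rw [Matrix.trace_mul_comm, hV, Matrix.trace_one, Fintype.card_fin]
  have hproj : V * Vᴴ * (V * Vᴴ) = V * Vᴴ := by
    rw [Matrix.mul_assoc, ← Matrix.mul_assoc Vᴴ, hV, Matrix.one_mul]
  have hO : (dO : ℂ) ≠ 0 := by rintro h; simp_all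
  have hE : (dE : ℂ) ≠ 0 := by rintro h; simp_all
  have hsq : (dO : ℂ) ^ 2 * (dE : ℂ) ^ 2 - 1 ≠ 0 := by
    rw [← mul_pow, sub_ne_zero]
    exact_mod_cast (Nat.one_lt_pow two_ne_zero hN).ne'
  have htwirl : (rightSwapOp (Fin dO) (Fin dE) * haarTwirl ((V * Vᴴ) ⊗ₖ (V * Vᴴ))).trace =
      (dO * dE * (dI * dI) - dI) / (dO * dE * (((dO : ℂ) * dE) ^ 2 - 1)) * ((dO : ℂ) ^ 2 * dE) +
        (dO * dE * dI - dI * dI) / (dO * dE * (((dO : ℂ) * dE) ^ 2 - 1)) * (dO * (dE : ℂ) ^ 2) := by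
    rw [haarTwirl_eq, Matrix.trace_kronecker, trace_swapOp_mul_kronecker, hproj, htr,
      Matrix.mul_add, Matrix.mul_smul, Matrix.mul_smul, Matrix.mul_one, Matrix.trace_add,
      Matrix.trace_smul, Matrix.trace_smul, trace_rightSwapOp, trace_rightSwapOp_mul_swapOp]
    simp
  rw [integral_purity_unitary_mul, htwirl, ← Complex.ofReal_re (_ / _)]
  congr 1
  push_cast
  field_simp
  ring

variable (h : dI ≤ dO * dE)

theorem firstColumns_eq_mul (U : Matrix.unitaryGroup (Fin dO × Fin dE) ℂ) :
    firstColumns h U = U.1 * firstColumns h 1 := by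
  ext x i
  simp [firstColumns, Matrix.mul_apply, Matrix.one_apply]

theorem conjTranspose_firstColumns_mul_self (U : Matrix.unitaryGroup (Fin dO × Fin dE) ℂ) :
    (firstColumns h U)ᴴ * firstColumns h U = 1 := by
  have hinj : Function.Injective fun i => finProdFinEquiv.symm (Fin.castLE h i) :=
    finProdFinEquiv.symm.injective.comp (Fin.castLE_injective h)
  have hU : U.1ᴴ * U.1 = 1 := Matrix.mem_unitaryGroup_iff'.1 U.2
  calc (firstColumns h U)ᴴ * firstColumns h U
      = (U.1ᴴ * U.1).submatrix (fun i => finProdFinEquiv.symm (Fin.castLE h i))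
          fun i => finProdFinEquiv.symm (Fin.castLE h i) := rfl
    _ = 1 := by rw [hU, Matrix.submatrix_one _ hinj]

theorem haarExp_purity (hN : 2 ≤ dO * dE) :
    haarExp h purity =
      ((dI : ℝ) * dO * ((dE : ℝ) ^ 2 - 1) + (dI : ℝ) ^ 2 * dE * ((dO : ℝ) ^ 2 - 1)) /
        ((dO : ℝ) ^ 2 * (dE : ℝ) ^ 2 - 1) := by
  rw [haarExp, funext (firstColumns_eq_mul h)]
  exact integral_purity_of_isometry hN (conjTranspose_firstColumns_mul_self h 1)

end AveragePurity

section HaarAverages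

variable {dI dO dE : ℕ}

theorem continuous_choiOp :
    Continuous (choiOp : Matrix (Fin dO × Fin dE) (Fin dI) ℂ → Matrix _ _ ℂ) := by
  have henvMat : Continuous (envMat : Matrix (Fin dO × Fin dE) (Fin dI) ℂ → Matrix _ _ ℂ) :=
    continuous_matrix fun e p => continuous_id.matrix_elem (p.2, e) p.1
  rw [funext choiOp_eq_transpose]
  exact (henvMat.matrix_conjTranspose.matrix_mul henvMat).matrix_transpose

theorem continuous_eigSeq_choiOp (k : ℕ) :
    Continuous fun V : Matrix (Fin dO × Fin dE) (Fin dI) ℂ => eigSeq (choiOp V) k :=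
  continuous_eigSeq continuous_choiOp choiOp_isHermitian k

theorem continuous_purity : Continuous (purity : Matrix (Fin dO × Fin dE) (Fin dI) ℂ → ℝ) :=
  Complex.continuous_re.comp (continuous_choiOp.matrix_mul continuous_choiOp).matrix_trace

variable (h : dI ≤ dO * dE)

theorem continuous_firstColumns : Continuous (firstColumns h) :=
  continuous_matrix fun x _ => continuous_subtype_val.matrix_elem x _

theorem haarIntegrable_of_continuous {f : Matrix (Fin dO × Fin dE) (Fin dI) ℂ → ℝ}
    (hf : Continuous f) : HaarIntegrable h f :=
  integrable_haarUnitary (hf.comp (continuous_firstColumns h))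

theorem haarIntegrable_eigSeq_choiOp_sq (k : ℕ) :
    HaarIntegrable h fun V => eigSeq (choiOp V) k ^ 2 :=
  haarIntegrable_of_continuous h ((continuous_eigSeq_choiOp k).pow 2)

theorem haarIntegrable_orderedEig_sq (i : Fin (Fintype.card (Fin dI × Fin dO))) :
    HaarIntegrable h fun V => orderedEig V i ^ 2 := by
  simpa only [orderedEig_eq_eigSeq] using haarIntegrable_eigSeq_choiOp_sq h i

theorem haarIntegrable_bestDist2 {ρ : Matrix (Fin dE) (Fin dE) ℂ} (hρ : ρ.PosSemidef) :
    HaarIntegrable h (bestDist2 ρ) := by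
  have htrace : Continuous fun V : Matrix (Fin dO × Fin dE) (Fin dI) ℂ => (Vᴴ * V).trace.re :=
    Complex.continuous_re.comp
      (continuous_id.matrix_conjTranspose.matrix_mul continuous_id).matrix_trace
  rw [funext (bestDist2_eq hρ)]
  exact haarIntegrable_of_continuous h (((continuous_purity.mul continuous_const).add
    (htrace.pow 2)).sub (continuous_const.mul (continuous_finsetSum _ fun k _ =>
      continuous_const.mul ((continuous_eigSeq_choiOp k).pow 2))))

/-- The mean square `𝔼 c_k²` of the `k`-th largest eigenvalue of the Choi operator, counted from
`k = 0`. It is defined for all `k : ℕ`, with value `0` beyond the size of the Choi operator. -/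
noncomputable def meanEigSq (k : ℕ) : ℝ :=
  haarExp h fun V => eigSeq (choiOp V) k ^ 2

theorem meanEigSq_nonneg (k : ℕ) : 0 ≤ meanEigSq h k :=
  integral_nonneg fun _ => sq_nonneg _

theorem meanEigSq_antitone : Antitone (meanEigSq h) := fun k l hkl =>
  integral_mono (haarIntegrable_eigSeq_choiOp_sq h l) (haarIntegrable_eigSeq_choiOp_sq h k)
    fun _ => pow_le_pow_left₀ (eigSeq_nonneg (choiOp_posSemidef _) l)
      (eigSeq_antitone (choiOp_posSemidef _) hkl) 2

theorem meanEigSq_of_le {k : ℕ} (hk : dE ≤ k) : meanEigSq h k = 0 := by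
  simp [meanEigSq, haarExp, eigSeq_choiOp_of_le _ hk]

theorem meanEigSq_of_card_le {k : ℕ} (hk : Fintype.card (Fin dI × Fin dO) ≤ k) :
    meanEigSq h k = 0 := by
  simp [meanEigSq, haarExp, eigSeq_of_card_le _ hk]

theorem sum_haarExp_orderedEig_sq_sq :
    ∑ i, haarExp h (fun V => orderedEig V i ^ 2) ^ 2 =
      ∑ k ∈ Finset.range dE, meanEigSq h k ^ 2 := by
  set d := Fintype.card (Fin dI × Fin dO)
  have hdE : ∀ k ≥ dE, meanEigSq h k ^ 2 = 0 := fun k hk => by simp [meanEigSq_of_le h hk]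
  have hdIO : ∀ k ≥ d, meanEigSq h k ^ 2 = 0 := fun k hk => by simp [meanEigSq_of_card_le h hk]
  simp only [orderedEig_eq_eigSeq]
  calc ∑ i : Fin d, meanEigSq h i ^ 2
      = ∑ k ∈ Finset.range d, meanEigSq h k ^ 2 :=
        Fin.sum_univ_eq_sum_range (fun k => meanEigSq h k ^ 2) d
    _ = ∑ k ∈ Finset.range (max d dE), meanEigSq h k ^ 2 :=
        (Finset.eventually_constant_sum hdIO (le_max_left d dE)).symm
    _ = ∑ k ∈ Finset.range dE, meanEigSq h k ^ 2 :=
        Finset.eventually_constant_sum hdE (le_max_right d dE)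

theorem sum_meanEigSq : ∑ k ∈ Finset.range dE, meanEigSq h k = haarExp h purity := by
  simp only [haarExp, purity_eq_sum_eigSeq_sq, meanEigSq]
  exact (integral_finsetSum _ fun k _ => haarIntegrable_eigSeq_choiOp_sq h k).symm

theorem haarExp_purity_pos (hI : 1 ≤ dI) (hN : 2 ≤ dO * dE) : 0 < haarExp h purity := by
  have hI' : (1 : ℝ) ≤ dI := by exact_mod_cast hI
  have hO : (1 : ℝ) ≤ dO := by exact_mod_cast Nat.pos_of_mul_pos_right (by omega : 0 < dO * dE)
  have hE : (1 : ℝ) ≤ dE := by exact_mod_cast Nat.pos_of_mul_pos_left (by omega : 0 < dO * dE)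
  have hN' : (1 : ℝ) < dO * dE := by exact_mod_cast hN
  rw [haarExp_purity h hN]
  refine div_pos ?_ (by nlinarith)
  calc (0 : ℝ) < dI * (dO + dE) * (dO * dE - 1) :=
        mul_pos (by positivity) (sub_pos.2 hN')
    _ ≤ dI * (dO + dE) * (dO * dE - 1) + dI * (dI - 1) * dE * ((dO : ℝ) ^ 2 - 1) :=
        le_add_of_nonneg_right (mul_nonneg (mul_nonneg (mul_nonneg (by positivity)
          (sub_nonneg.2 hI')) (by positivity)) (sub_nonneg.2 (one_le_pow₀ hO)))
    _ = _ := by ring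

end HaarAverages

section AppendError

variable {dI dO dE : ℕ} (h : dI ≤ dO * dE) {ρ : Matrix (Fin dE) (Fin dE) ℂ}

theorem appError_eq (hρ : ρ.PosSemidef) :
    appError h ρ = haarExp h purity * ∑ k ∈ Finset.range dE, eigSeq ρ k ^ 2 + (dI : ℝ) ^ 2 -
      2 * ∑ k ∈ Finset.range dE, eigSeq ρ k * meanEigSq h k := by
  have hpurity : Integrable (fun U => purity (firstColumns h U) *
      ∑ k ∈ Finset.range dE, eigSeq ρ k ^ 2 + (dI : ℝ) ^ 2) (haarUnitary _) :=
    ((haarIntegrable_of_continuous h continuous_purity).mul_const _).add (integrable_const _)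
  have hoverlap : ∀ k ∈ Finset.range dE, Integrable (fun U =>
      eigSeq ρ k * eigSeq (choiOp (firstColumns h U)) k ^ 2) (haarUnitary _) :=
    fun k _ => (haarIntegrable_eigSeq_choiOp_sq h k).const_mul _
  have htrace (U : Matrix.unitaryGroup (Fin dO × Fin dE) ℂ) :
      ((firstColumns h U)ᴴ * firstColumns h U).trace.re = dI := by
    simp [conjTranspose_firstColumns_mul_self]
  simp only [appError, haarExp, bestDist2_eq hρ, htrace, meanEigSq]
  rw [integral_sub hpurity ((integrable_finsetSum _ hoverlap).const_mul 2),
    integral_add ((haarIntegrable_of_continuous h continuous_purity).mul_const _)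
      (integrable_const _), integral_mul_const, integral_const_mul,
    integral_finsetSum _ hoverlap]
  simp [integral_const_mul]

theorem appError_eq_add_sum_sq (hP : haarExp h purity ≠ 0) (hρ : ρ.PosSemidef) :
    appError h ρ = (dI : ℝ) ^ 2 -
      (∑ k ∈ Finset.range dE, meanEigSq h k ^ 2) / haarExp h purity + haarExp h purity *
        ∑ k ∈ Finset.range dE, (eigSeq ρ k - meanEigSq h k / haarExp h purity) ^ 2 := by
  set P := haarExp h purity
  have hsquare : P * ∑ k ∈ Finset.range dE, (eigSeq ρ k - meanEigSq h k / P) ^ 2 =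
      P * ∑ k ∈ Finset.range dE, eigSeq ρ k ^ 2 -
        2 * ∑ k ∈ Finset.range dE, eigSeq ρ k * meanEigSq h k +
          (∑ k ∈ Finset.range dE, meanEigSq h k ^ 2) / P := by
    rw [Finset.mul_sum, Finset.mul_sum, Finset.mul_sum, Finset.sum_div, ← Finset.sum_sub_distrib,
      ← Finset.sum_add_distrib]
    refine Finset.sum_congr rfl fun k _ => ?_
    field_simp
    ring
  rw [appError_eq h hρ, hsquare]
  ring

/-- The state on the environment with eigenvalues `𝔼 c_k² / 𝔼 tr C²`, which minimizes the average
error among the appended states. -/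
noncomputable def optState : Matrix (Fin dE) (Fin dE) ℂ :=
  Matrix.diagonal fun i => ((meanEigSq h i / haarExp h purity : ℝ) : ℂ)

theorem optState_mem_densityMatrices (hP : 0 < haarExp h purity) :
    optState h ∈ densityMatrices dE := by
  refine ⟨Matrix.PosSemidef.diagonal fun i => ?_, ?_⟩
  · exact Complex.zero_le_real.2 (div_nonneg (meanEigSq_nonneg h i) hP.le)
  · rw [optState, Matrix.trace_diagonal, ← Complex.ofReal_sum, ← Finset.sum_div,
      Fin.sum_univ_eq_sum_range, sum_meanEigSq, div_self hP.ne', Complex.ofReal_one]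

theorem eigSeq_optState (hP : 0 < haarExp h purity) {k : ℕ} (hk : k < dE) :
    eigSeq (optState h) k = meanEigSq h k / haarExp h purity :=
  eigSeq_diagonal (finCongr (Fintype.card_fin dE)).symm
    (fun _ _ hkl => div_le_div_of_nonneg_right (meanEigSq_antitone h hkl) hP.le) (by simpa using hk)

theorem isLeast_appError (hP : 0 < haarExp h purity) :
    IsLeast (appError h '' densityMatrices dE)
      ((dI : ℝ) ^ 2 - (∑ k ∈ Finset.range dE, meanEigSq h k ^ 2) / haarExp h purity) := by
  have hopt := optState_mem_densityMatrices h hP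
  refine ⟨⟨optState h, hopt, ?_⟩, ?_⟩
  · rw [appError_eq_add_sum_sq h hP.ne' hopt.1, add_eq_left, mul_eq_zero]
    refine Or.inr (Finset.sum_eq_zero fun k hk => ?_)
    rw [eigSeq_optState h hP (Finset.mem_range.1 hk), sub_self, zero_pow two_ne_zero]
  · rintro _ ⟨ρ, hρ, rfl⟩
    rw [appError_eq_add_sum_sq h hP.ne' hρ.1]
    exact le_add_of_nonneg_right (mul_nonneg hP.le (Finset.sum_nonneg fun _ _ => sq_nonneg _))

theorem epsApp_eq (hP : 0 < haarExp h purity) :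
    epsApp h = (dI : ℝ) ^ 2 -
      (∑ i, haarExp h (fun V => orderedEig V i ^ 2) ^ 2) / haarExp h purity := by
  rw [sum_haarExp_orderedEig_sq_sq]
  exact (isLeast_appError h hP).csInf_eq

theorem isLeast_epsApp (hP : 0 < haarExp h purity) :
    IsLeast (appError h '' densityMatrices dE) (epsApp h) := by
  rw [epsApp_eq h hP, sum_haarExp_orderedEig_sq_sq]
  exact isLeast_appError h hP

theorem sub_haarExp_purity_le_epsApp (hP : 0 < haarExp h purity) :
    (dI : ℝ) ^ 2 - haarExp h purity ≤ epsApp h := by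
  rw [epsApp_eq h hP, sum_haarExp_orderedEig_sq_sq]
  refine sub_le_sub_left ((div_le_iff₀ hP).2 ?_) _
  rw [← sq, ← sum_meanEigSq]
  exact Finset.sum_sq_le_sq_sum_of_nonneg fun k _ => meanEigSq_nonneg h k

theorem maxMixed_mem_densityMatrices (hE : 1 ≤ dE) : maxMixed dE ∈ densityMatrices dE := by
  have hd : (dE : ℂ) ≠ 0 := Nat.cast_ne_zero.2 (by omega)
  exact ⟨Matrix.PosSemidef.one.smul (by simp), by simp [maxMixed, hd]⟩

theorem eigSeq_maxMixed {k : ℕ} (hk : k < dE) : eigSeq (maxMixed dE) k = (dE : ℝ)⁻¹ := by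
  have hdiag : maxMixed dE = Matrix.diagonal fun _ => (((dE : ℝ)⁻¹ : ℝ) : ℂ) := by
    simp [maxMixed, Matrix.smul_one_eq_diagonal]
  rw [hdiag]
  exact eigSeq_diagonal (finCongr (Fintype.card_fin dE)).symm antitone_const (by simpa using hk)

theorem appError_maxMixed (hE : 1 ≤ dE) :
    appError h (maxMixed dE) = (dI : ℝ) ^ 2 - 1 / (dE : ℝ) * haarExp h purity := by
  have hd : (dE : ℝ) ≠ 0 := Nat.cast_ne_zero.2 (by omega)
  have heig : ∀ k ∈ Finset.range dE, eigSeq (maxMixed dE) k = (dE : ℝ)⁻¹ := fun k hk =>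
    eigSeq_maxMixed (Finset.mem_range.1 hk)
  rw [appError_eq h (maxMixed_mem_densityMatrices hE).1,
    Finset.sum_congr rfl fun k hk => congrArg (· ^ 2) (heig k hk),
    Finset.sum_congr rfl fun k hk => congrArg (· * meanEigSq h k) (heig k hk),
    ← Finset.mul_sum, sum_meanEigSq, Finset.sum_const, Finset.card_range, nsmul_eq_mul]
  field_simp
  ring

end AppendError

end AppendEnv

theorem mainTheorem4 (dI dO dE : ℕ) (hI : 1 ≤ dI) (hO : 2 ≤ dO) (hE : 1 ≤ dE)
    (h : dI ≤ dO * dE) :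
    -- the minimum over the environment unitaries is attained
    (∀ ρ ∈ AppendEnv.densityMatrices dE, ∀ V : Matrix (Fin dO × Fin dE) (Fin dI) ℂ,
      IsLeast (Set.range (AppendEnv.dist2 ρ V)) (AppendEnv.bestDist2 ρ V)) ∧
    -- the expectations are well defined
    (∀ ρ ∈ AppendEnv.densityMatrices dE,
      AppendEnv.HaarIntegrable h (AppendEnv.bestDist2 ρ)) ∧
    (∀ i, AppendEnv.HaarIntegrable h (fun V => AppendEnv.orderedEig V i ^ 2)) ∧
    AppendEnv.HaarIntegrable h AppendEnv.purity ∧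
    -- the minimum over the appended states is attained
    IsLeast (AppendEnv.appError h '' AppendEnv.densityMatrices dE) (AppendEnv.epsApp h) ∧
    -- the average purity
    AppendEnv.haarExp h AppendEnv.purity =
      ((dI : ℝ) * dO * ((dE : ℝ) ^ 2 - 1) + (dI : ℝ) ^ 2 * dE * ((dO : ℝ) ^ 2 - 1)) /
        ((dO : ℝ) ^ 2 * (dE : ℝ) ^ 2 - 1) ∧
    -- the minimal error, in terms of the average purity and explicitly
    AppendEnv.epsApp h = (dI : ℝ) ^ 2 -
      (∑ i, AppendEnv.haarExp h (fun V => AppendEnv.orderedEig V i ^ 2) ^ 2) /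
        AppendEnv.haarExp h AppendEnv.purity ∧
    AppendEnv.epsApp h = (dI : ℝ) ^ 2 -
      ((dO : ℝ) ^ 2 * (dE : ℝ) ^ 2 - 1) /
        ((dI : ℝ) * dO * ((dE : ℝ) ^ 2 - 1) + (dI : ℝ) ^ 2 * dE * ((dO : ℝ) ^ 2 - 1)) *
      ∑ i, AppendEnv.haarExp h (fun V => AppendEnv.orderedEig V i ^ 2) ^ 2 ∧
    -- the two-sided bounds
    (dI : ℝ) ^ 2 -
      ((dI : ℝ) * dO * ((dE : ℝ) ^ 2 - 1) + (dI : ℝ) ^ 2 * dE * ((dO : ℝ) ^ 2 - 1)) /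
        ((dO : ℝ) ^ 2 * (dE : ℝ) ^ 2 - 1) ≤ AppendEnv.epsApp h ∧
    AppendEnv.epsApp h ≤ (dI : ℝ) ^ 2 - 1 / (dE : ℝ) *
      (((dI : ℝ) * dO * ((dE : ℝ) ^ 2 - 1) + (dI : ℝ) ^ 2 * dE * ((dO : ℝ) ^ 2 - 1)) /
        ((dO : ℝ) ^ 2 * (dE : ℝ) ^ 2 - 1)) ∧
    -- the maximally mixed state is a state whose error is exactly the upper bound
    AppendEnv.maxMixed dE ∈ AppendEnv.densityMatrices dE ∧
    AppendEnv.appError h (AppendEnv.maxMixed dE) = (dI : ℝ) ^ 2 - 1 / (dE : ℝ) *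
      (((dI : ℝ) * dO * ((dE : ℝ) ^ 2 - 1) + (dI : ℝ) ^ 2 * dE * ((dO : ℝ) ^ 2 - 1)) /
        ((dO : ℝ) ^ 2 * (dE : ℝ) ^ 2 - 1)) := by
  have hN : 2 ≤ dO * dE := hO.trans (Nat.le_mul_of_pos_right dO hE)
  have hP := AppendEnv.haarExp_purity_pos h hI hN
  have hleast := AppendEnv.isLeast_epsApp h hP
  have heps := AppendEnv.epsApp_eq h hP
  have hlower := AppendEnv.sub_haarExp_purity_le_epsApp h hP
  have hmem := AppendEnv.maxMixed_mem_densityMatrices hE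
  have hmixed := AppendEnv.appError_maxMixed h hE
  have hupper := hmixed ▸ hleast.2 ⟨_, hmem, rfl⟩
  have hpurity := AppendEnv.haarExp_purity h hN
  rw [hpurity] at hlower hupper hmixed
  refine ⟨fun ρ hρ => AppendEnv.isLeast_bestDist2 hρ.1,
    fun ρ hρ => AppendEnv.haarIntegrable_bestDist2 h hρ.1,
    AppendEnv.haarIntegrable_orderedEig_sq h,
    AppendEnv.haarIntegrable_of_continuous h AppendEnv.continuous_purity,
    hleast, hpurity, heps, ?_, hlower, hupper, hmem, hmixed⟩
  rw [heps, hpurity, div_eq_inv_mul _ (_ / _), inv_div]
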